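/- Theorem 2.3. Let $p$ be a prime, let $k$ be a field of characteristic $p$, let $G$ be a finite group, and let $\Omega$ be a finite $G$-set with associated permutation module $k\Omega$. For a $kG$-module $M$, a vertex of $M$ is a subgroup $H \le G$ that is minimal (with respect to inclusion) among the subgroups $H$ for which there is a $kH$-module $L$ such that $M$ is isomorphic to a direct summand of $\mathrm{Ind}_H^G(L)$. Let $M$ be an indecomposable direct summand of $k\Omega$ and let $Q$ be a vertex of $M$. Let $X = \{\omega \in \Omega : g\omega = \omega \text{ for all } g \in Q\}$ be the set of fixed points of $Q$ on $\Omega$, and let $S = \{g \in G : gx = x \text{ for all } x \in X\}$ be the pointwise stabiliser of $X$ in $G$. Then $Q$ is a Sylow $p$-subgroup of $S$. -/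

import Mathlib

namespace ModRep

universe u v w x

/-- `M` is a component (direct summand) of `N`: there is a decomposition `N = W ⊕ W'` into
subrepresentations with `M` isomorphic to `W`. -/
def IsSummand {k : Type u} {G : Type w} [Field k] [Group G]
    {M : Type v} [AddCommGroup M] [Module k M] (ρ : Representation k G M)
    {N : Type x} [AddCommGroup N] [Module k N] (σ : Representation k G N) : Prop :=
  ∃ W W' : Subrepresentation σ, IsCompl W W' ∧ Nonempty (ρ.Equiv W.toRepresentation)

/-- A nonzero representation that has no decomposition into two nonzero subrepresentations. -/
def IsIndecomposable {k : Type u} {G : Type w} [Field k] [Group G]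
    {M : Type v} [AddCommGroup M] [Module k M] (ρ : Representation k G M) : Prop :=
  Nontrivial M ∧ ∀ W W' : Subrepresentation ρ, IsCompl W W' → W = ⊥ ∨ W' = ⊥

/-- There is a representation `L` of the subgroup `H` such that `M` is a component of
`Ind_H^G L`. -/
def IsRelativelyProjective {k : Type u} {G : Type w} [Field k] [Group G]
    {M : Type v} [AddCommGroup M] [Module k M] (ρ : Representation k G M)
    (H : Subgroup G) : Prop :=
  ∃ (L : Type v) (_ : AddCommGroup L) (_ : Module k L) (τ : Representation k H L),
    IsSummand ρ (Representation.ind H.subtype τ)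

/-- `Q` is a vertex of `M`: a subgroup that is minimal (for inclusion) among those `H ≤ G` for
which `M` is a component of some module induced from `H`. -/
def IsVertex {k : Type u} {G : Type w} [Field k] [Group G]
    {M : Type v} [AddCommGroup M] [Module k M] (ρ : Representation k G M)
    (Q : Subgroup G) : Prop :=
  Minimal (fun H : Subgroup G => IsRelativelyProjective ρ H) Q

end ModRep

namespace ModRep

/-! Split `M` off `kΩ` by equivariant `i`, `π` with `π ∘ i = 1`, and describe an endomorphism `f` of
`M` by the matrix of `i ∘ f ∘ π` over `Ω × Ω`. By Higman's criterion (`isRelativelyProjective_iff`),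
`1` is the relative trace of some `Q`-endomorphism `θ`; hence `Q` is a `p`-group. The main step,
`IsVertex.exists_matEntry_ne_zero`, finds a `Q`-fixed pair `z` at which the matrix of `1` is
nonzero. Otherwise the entries of `θ` vanish at all `Q`-fixed pairs, so `1` is a sum of traces from
proper subgroups of `Q`; locality of the endomorphism ring makes one of them a unit, against
minimality of `Q`. Both coordinates of `z` lie in `X`, so a Sylow `p`-subgroup `P ≥ Q` of `S` fixes
`z`. Counting modulo `p` in the trace of `θ`, `P` fixes a coset `gQ`
(`exists_mem_fixedPoints_quotient`). Thus `g⁻¹Pg ≤ Q`, and `P = Q`. -/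

/-- The relative trace of a vector `a` of a representation of `G`, where `a` is meant to be fixed by
the subgroup `H`: the sum of the `g • a` over the cosets `gH`. -/
noncomputable def relTrace {k G A : Type*} [Field k] [Group G] [AddCommGroup A] [Module k A]
    (α : Representation k G A) (H : Subgroup G) (a : A) : A :=
  ∑ᶠ q : G ⧸ H, α q.out a

/-! ### Relative traces -/

section RelTrace

variable {k G A B : Type*} [Field k] [Group G] [AddCommGroup A] [Module k A]
  [AddCommGroup B] [Module k B] (α : Representation k G A) (β : Representation k G B)

lemma apply_out_of_fixed {H : Subgroup G} {a : A} (ha : ∀ h ∈ H, α h a = a) (g : G) :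
    α (g : G ⧸ H).out a = α g a := by
  obtain ⟨h, hh⟩ := QuotientGroup.mk_out_eq_mul H g
  rw [hh, map_mul, Module.End.mul_apply, ha h h.2]

lemma apply_out_smul_of_fixed {H : Subgroup G} {a : A} (ha : ∀ h ∈ H, α h a = a) (g : G)
    (q : G ⧸ H) : α (g • q).out a = α g (α q.out a) := by
  induction q using QuotientGroup.induction_on with
  | H x =>
    rw [MulAction.Quotient.smul_coe, apply_out_of_fixed α ha, apply_out_of_fixed α ha, smul_eq_mul,
      map_mul, Module.End.mul_apply]

lemma relTrace_eq_sum (H : Subgroup G) [Fintype (G ⧸ H)] (a : A) :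
    relTrace α H a = ∑ q : G ⧸ H, α q.out a := finsum_eq_sum_of_fintype _

variable [Finite G]

lemma apply_relTrace {H : Subgroup G} {a : A} (ha : ∀ h ∈ H, α h a = a) (g : G) :
    α g (relTrace α H a) = relTrace α H a := by
  have := Fintype.ofFinite (G ⧸ H)
  rw [relTrace_eq_sum, map_sum,
    ← Equiv.sum_comp (MulAction.toPerm g) fun q : G ⧸ H => α q.out a]
  simp [apply_out_smul_of_fixed α ha]

variable {α β} in
lemma map_relTrace (T : A →ₗ[k] B) (hT : ∀ g a, T (α g a) = β g (T a)) (H : Subgroup G) (a : A) :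
    T (relTrace α H a) = relTrace β H (T a) := by
  have := Fintype.ofFinite (G ⧸ H)
  simp [relTrace_eq_sum, hT]

lemma relTrace_sum {ι : Type*} (s : Finset ι) (H : Subgroup G) (a : ι → A) :
    relTrace α H (∑ i ∈ s, a i) = ∑ i ∈ s, relTrace α H (a i) := by
  have := Fintype.ofFinite (G ⧸ H)
  simp only [relTrace_eq_sum, map_sum]
  exact Finset.sum_comm

lemma relTrace_smul (H : Subgroup G) (c : k) (a : A) :
    relTrace α H (c • a) = c • relTrace α H a := by
  have := Fintype.ofFinite (G ⧸ H)
  simp [relTrace_eq_sum, Finset.smul_sum]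

/-- Products of representatives of `G ⧸ K` and of `K ⧸ H` represent `G ⧸ H`. -/
lemma relTrace_trans {H K : Subgroup G} (hHK : H ≤ K) {a : A} (ha : ∀ h ∈ H, α h a = a) :
    relTrace α K (relTrace (α.comp K.subtype) (H.subgroupOf K) a) = relTrace α H a := by
  have := Fintype.ofFinite (G ⧸ H)
  have := Fintype.ofFinite (G ⧸ K)
  have := Fintype.ofFinite (K ⧸ H.subgroupOf K)
  simp only [relTrace_eq_sum, map_sum]
  rw [← Fintype.sum_prod_type', ← Equiv.sum_comp (Subgroup.quotientEquivProdOfLE hHK).symm]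
  refine Finset.sum_congr rfl fun x _ => ?_
  obtain ⟨q, r⟩ := x
  have : (Subgroup.quotientEquivProdOfLE hHK).symm (q, r) = ((q.out * r.out : G) : G ⧸ H) := by
    conv_lhs => rw [← QuotientGroup.out_eq' r]
    rfl
  rw [this, apply_out_of_fixed α ha, map_mul]
  rfl

end RelTrace

/-! ### Summands as equivariant split injections -/

section Summand

variable {k G M N : Type*} [Field k] [Group G] [AddCommGroup M] [Module k M]
  [AddCommGroup N] [Module k N] {ρ : Representation k G M} {σ : Representation k G N}

lemma isCompl_iff_toSubmodule {W W' : Subrepresentation σ} :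
    IsCompl W W' ↔ IsCompl W.toSubmodule W'.toSubmodule := by
  have hinf : W ⊓ W' = ⊥ ↔ W.toSubmodule ⊓ W'.toSubmodule = ⊥ :=
    Subrepresentation.toSubmodule_injective.eq_iff.symm
  have hsup : W ⊔ W' = ⊤ ↔ W.toSubmodule ⊔ W'.toSubmodule = ⊤ :=
    Subrepresentation.toSubmodule_injective.eq_iff.symm
  rw [isCompl_iff, isCompl_iff, disjoint_iff, disjoint_iff, codisjoint_iff, codisjoint_iff, hinf,
    hsup]

lemma isSummand_iff : IsSummand ρ σ ↔ ∃ (i : M →ₗ[k] N) (π : N →ₗ[k] M),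
    (∀ g m, i (ρ g m) = σ g (i m)) ∧ (∀ g n, π (σ g n) = ρ g (π n)) ∧ ∀ m, π (i m) = m := by
  constructor
  · rintro ⟨W, W', h, ⟨e⟩⟩
    rw [isCompl_iff_toSubmodule] at h
    have he (g : G) (m : M) : e (ρ g m) = W.toRepresentation g (e m) :=
      LinearMap.congr_fun (e.isIntertwining' g) m
    have he' (g : G) (w : W.toSubmodule) : e.symm (W.toRepresentation g w) = ρ g (e.symm w) :=
      LinearMap.congr_fun (e.symm.isIntertwining' g) w
    refine ⟨W.toSubmodule.subtype ∘ₗ e.toLinearMap,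
      e.symm.toLinearMap ∘ₗ Submodule.projectionOnto _ _ h, fun g m => ?_, fun g n => ?_,
      fun m => ?_⟩
    · exact congrArg Subtype.val (he g m)
    · refine Eq.trans (congrArg e.symm ?_) (he' g _)
      obtain ⟨w, w', rfl⟩ : ∃ (w : W.toSubmodule) (w' : W'.toSubmodule), (w : N) + w' = n := by
        have : n ∈ W.toSubmodule ⊔ W'.toSubmodule := by rw [h.sup_eq_top]; trivial
        obtain ⟨a, ha, b, hb, hab⟩ := Submodule.mem_sup.1 this
        exact ⟨⟨a, ha⟩, ⟨b, hb⟩, hab⟩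
      have h1 : σ g (w : N) = (W.toRepresentation g w : N) := rfl
      have h2 : σ g (w' : N) = (W'.toRepresentation g w' : N) := rfl
      rw [map_add, h1, h2, map_add, map_add]
      simp
    · refine Eq.trans (congrArg e.symm ?_) (e.symm_apply_apply m)
      exact Submodule.projectionOnto_apply_left h (e m)
  · rintro ⟨i, π, hi, hπ, hπi⟩
    refine ⟨⟨LinearMap.range i, ?_⟩, ⟨LinearMap.ker π, ?_⟩, ?_, ⟨?_⟩⟩
    · rintro g _ ⟨m, rfl⟩
      exact ⟨ρ g m, hi g m⟩
    · intro g v hv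
      rw [LinearMap.mem_ker] at hv ⊢
      rw [hπ, hv, map_zero]
    · rw [isCompl_iff_toSubmodule]
      refine ⟨?_, ?_⟩
      · rw [Submodule.disjoint_def]
        rintro _ ⟨m, rfl⟩ hm
        rw [LinearMap.mem_ker, hπi] at hm
        rw [hm, map_zero]
      · rw [codisjoint_iff, eq_top_iff]
        intro n _
        refine Submodule.mem_sup.2 ⟨i (π n), ⟨_, rfl⟩, n - i (π n), ?_, by simp⟩
        rw [LinearMap.mem_ker, map_sub, hπi, sub_self]
    · refine Representation.Equiv.mk (LinearEquiv.ofInjective i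
        (Function.LeftInverse.injective hπi)) fun g => ?_
      ext m
      exact hi g m

end Summand

/-! ### Induced modules and Higman's criterion -/

section Higman

open Representation

universe u v w

variable {k : Type u} {G : Type w} {M : Type v} [Field k] [Group G] [AddCommGroup M] [Module k M]

section Ind

variable {L B : Type*} [AddCommGroup L] [Module k L] [AddCommGroup B] [Module k B]
  {H : Subgroup G}

lemma indV_hom_ext {τ : Representation k H L} {f g : IndV H.subtype τ →ₗ[k] B}
    (h : ∀ x l, f (IndV.mk H.subtype τ x l) = g (IndV.mk H.subtype τ x l)) : f = g :=
  IndV.hom_ext _ _ fun x => LinearMap.ext fun l => h x l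

/-- A linear map out of an induced representation, given by a compatible family of linear maps. -/
noncomputable def indLift (τ : Representation k H L) (f : G → L →ₗ[k] B)
    (hf : ∀ (h : H) g l, f (h * g) (τ h l) = f g l) : IndV H.subtype τ →ₗ[k] B :=
  Coinvariants.lift _ (TensorProduct.lift <| (Finsupp.lift _ _ _ f) ∘ₗ
      (MonoidAlgebra.coeffLinearEquiv k).toLinearMap) fun h => by
    ext g l
    simp [hf]

@[simp]
lemma indLift_mk (τ : Representation k H L) (f : G → L →ₗ[k] B)
    (hf : ∀ (h : H) g l, f (h * g) (τ h l) = f g l) (g : G) (l : L) :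
    indLift τ f hf (IndV.mk H.subtype τ g l) = f g l := by
  simp [indLift]

lemma indV_mk_mul (τ : Representation k H L) (h : H) (g : G) (l : L) :
    IndV.mk H.subtype τ (h * g) (τ h l) = IndV.mk H.subtype τ g l := by
  have := Coinvariants.mk_self_apply (Representation.tprod ((leftRegular k G).comp H.subtype) τ) h
    (TensorProduct.mk k _ _ (.single g 1) l)
  simpa using this

open Classical in
/-- The projection of an induced representation onto the summand `1 ⊗ L`. -/
noncomputable def indProj (τ : Representation k H L) : Module.End k (IndV H.subtype τ) :=
  indLift τ (fun g => if g ∈ H then IndV.mk H.subtype τ g else 0) fun h g l => by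
    by_cases hg : g ∈ H
    · rw [if_pos hg, if_pos (H.mul_mem h.2 hg), indV_mk_mul]
    · rw [if_neg hg, if_neg (mt (H.mul_mem_cancel_left h.2).1 hg)]
      simp

open Classical in
lemma indProj_mk (τ : Representation k H L) (g : G) (l : L) :
    indProj τ (IndV.mk H.subtype τ g l) = if g ∈ H then IndV.mk H.subtype τ g l else 0 := by
  rw [indProj, indLift_mk]
  split_ifs <;> rfl

lemma linHom_ind_indProj_mk (τ : Representation k H L) (g x : G) (l : L) [Decidable (x * g ∈ H)] :
    linHom (ind H.subtype τ) (ind H.subtype τ) g (indProj τ) (IndV.mk H.subtype τ x l) =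
      if x * g ∈ H then IndV.mk H.subtype τ x l else 0 := by
  simp only [linHom_apply, LinearMap.comp_apply (M₂ := IndV H.subtype τ), ind_mk, inv_inv,
    indProj_mk]
  split_ifs
  · rw [ind_mk, mul_inv_cancel_right]
  · rw [map_zero]

lemma linHom_indProj (τ : Representation k H L) (h : G) (hh : h ∈ H) :
    linHom (ind H.subtype τ) (ind H.subtype τ) h (indProj τ) = indProj τ := by
  classical
  refine indV_hom_ext fun x l => ?_
  rw [linHom_ind_indProj_mk, indProj_mk]
  simp only [H.mul_mem_cancel_right hh]

/-- The conjugate of `indProj` by `g` projects onto the block of those `x` with `x * g ∈ H`; each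
`x` lies in exactly one block, that of the coset `x⁻¹H`. -/
lemma relTrace_indProj [Finite G] (τ : Representation k H L) :
    relTrace (linHom (ind H.subtype τ) (ind H.subtype τ)) H (indProj τ) = 1 := by
  classical
  have := Fintype.ofFinite (G ⧸ H)
  refine indV_hom_ext fun x l => ?_
  simp only [relTrace_eq_sum, LinearMap.sum_apply, linHom_ind_indProj_mk, Module.End.one_apply]
  rw [Finset.sum_eq_single ((x⁻¹ : G) : G ⧸ H)]
  · rw [if_pos]
    obtain ⟨h, hh⟩ := QuotientGroup.mk_out_eq_mul H x⁻¹
    simp [hh]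
  · intro q _ hq
    rw [if_neg]
    contrapose! hq
    rw [← QuotientGroup.out_eq' q, eq_comm, QuotientGroup.eq]
    simpa using hq
  · simp

end Ind

lemma linHom_eq_self_iff {N : Type*} [AddCommGroup N] [Module k N] (ρ : Representation k G M)
    (σ : Representation k G N) (f : M →ₗ[k] N) (g : G) :
    linHom ρ σ g f = f ↔ ∀ m, f (ρ g m) = σ g (f m) := by
  rw [linHom_apply]
  constructor
  · intro h m
    conv_lhs => rw [← h]
    simp
  · intro h
    ext m
    simp [← h]

variable [Finite G]

/-- Higman's criterion. -/
lemma isRelativelyProjective_iff (ρ : Representation k G M) (H : Subgroup G) :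
    IsRelativelyProjective ρ H ↔ ∃ θ : Module.End k M,
      (∀ h ∈ H, linHom ρ ρ h θ = θ) ∧ relTrace (linHom ρ ρ) H θ = 1 := by
  constructor
  · rintro ⟨L, _, _, τ, h⟩
    obtain ⟨i, π, hi, hπ, hπi⟩ := isSummand_iff.1 h
    let σ := ind H.subtype τ
    -- Compression to `M` is equivariant, so it carries `relTrace_indProj` to a trace equal to `π ∘
    -- i = 1`.
    let T : Module.End k (IndV H.subtype τ) →ₗ[k] Module.End k M :=
      { toFun f := π ∘ₗ f ∘ₗ i
        map_add' f f' := by ext; simp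
        map_smul' c f := by ext; simp }
    have hT (g : G) (f : Module.End k (IndV H.subtype τ)) :
        T (linHom σ σ g f) = linHom ρ ρ g (T f) := by
      ext m
      simp only [T, LinearMap.coe_mk, AddHom.coe_mk, linHom_apply, LinearMap.comp_apply, hi]
      exact hπ _ _
    refine ⟨T (indProj τ), fun h hh => ?_, ?_⟩
    · rw [← hT, linHom_indProj τ h hh]
    · rw [← map_relTrace T hT, relTrace_indProj]
      ext m
      exact hπi m
  · rintro ⟨θ, hθ, hθ1⟩
    let τ : Representation k H M := ρ.comp H.subtype
    let σ := ind H.subtype τ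
    -- `ι` is only `H`-equivariant; its trace is `G`-equivariant and becomes the section, since `π ∘
    -- ι = θ` has trace `1`.
    let ι : M →ₗ[k] IndV H.subtype τ := IndV.mk H.subtype τ 1 ∘ₗ θ
    have hι : ∀ h ∈ H, linHom ρ σ h ι = ι := by
      intro h hh
      rw [linHom_eq_self_iff]
      intro m
      have h1 := (linHom_eq_self_iff ρ ρ θ h).1 (hθ h hh) m
      have h2 := indV_mk_mul τ ⟨h, hh⟩ h⁻¹ (θ m)
      simp only [mul_inv_cancel] at h2
      change IndV.mk H.subtype τ 1 (θ (ρ h m)) = ind H.subtype τ h (IndV.mk H.subtype τ 1 (θ m))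
      rw [ind_mk, h1, one_mul, ← h2]
      rfl
    let π : IndV H.subtype τ →ₗ[k] M := indLift τ (fun g => ρ g⁻¹) fun h g m => by
      change ρ _ (ρ h m) = _
      rw [← Module.End.mul_apply, ← map_mul]
      simp
    have hπ (g : G) (n : IndV H.subtype τ) : π (σ g n) = ρ g (π n) := by
      refine LinearMap.congr_fun (f := π ∘ₗ σ g) (g := ρ g ∘ₗ π)
        (indV_hom_ext fun x l => ?_) n
      change π (ind H.subtype τ g (IndV.mk H.subtype τ x l)) = ρ g (π (IndV.mk H.subtype τ x l))
      rw [ind_mk, indLift_mk, indLift_mk, ← Module.End.mul_apply, ← map_mul]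
      simp
    let T : (M →ₗ[k] IndV H.subtype τ) →ₗ[k] Module.End k M := LinearMap.llcomp k _ _ _ π
    have hT (g : G) (f : M →ₗ[k] IndV H.subtype τ) :
        T (linHom ρ σ g f) = linHom ρ ρ g (T f) := by
      ext m
      exact hπ _ _
    have hTι : T ι = θ := by
      ext m
      change π (IndV.mk H.subtype τ 1 (θ m)) = θ m
      rw [indLift_mk]
      simp
    refine ⟨M, inferInstance, inferInstance, τ, isSummand_iff.2
      ⟨relTrace (linHom ρ σ) H ι, π, fun g => ?_, hπ, fun m => ?_⟩⟩
    · exact (linHom_eq_self_iff ρ σ _ g).1 (apply_relTrace _ hι g)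
    · have := map_relTrace T hT H ι
      rw [hTι, hθ1] at this
      exact LinearMap.congr_fun this m

end Higman

open Representation

/-! ### Fitting's lemma and local endomorphism rings -/

section Fitting

variable {k G M : Type*} [Field k] [Group G] [AddCommGroup M] [Module k M]
  {ρ : Representation k G M}

lemma units_inv_apply_comm (u : (Module.End k M)ˣ)
    (hu : ∀ g m, (u : Module.End k M) (ρ g m) = ρ g ((u : Module.End k M) m)) (g : G) (m : M) :
    (↑u⁻¹ : Module.End k M) (ρ g m) = ρ g ((↑u⁻¹ : Module.End k M) m) :=
  LinearMap.congr_fun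
    (Commute.units_inv_left (LinearMap.ext (hu g) : Commute (u : Module.End k M) (ρ g))) m

variable [FiniteDimensional k M]

/-- For large `n`, `M` is the direct sum of the kernel and the range of `f ^ n`, both
subrepresentations. -/
lemma IsIndecomposable.isNilpotent_or_isUnit (hρ : IsIndecomposable ρ) (f : Module.End k M)
    (hf : ∀ g m, f (ρ g m) = ρ g (f m)) : IsNilpotent f ∨ IsUnit f := by
  obtain ⟨n, hn, hn0⟩ := (f.eventually_isCompl_ker_pow_range_pow.and
    (Filter.eventually_gt_atTop 0)).exists
  have hfn (g : G) (m : M) : (f ^ n) (ρ g m) = ρ g ((f ^ n) m) := by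
    have h : Commute (f ^ n) (ρ g) := Commute.pow_left (LinearMap.ext (hf g)) n
    exact LinearMap.congr_fun h m
  let W : Subrepresentation ρ := ⟨LinearMap.ker (f ^ n), fun g v hv => by
    rw [LinearMap.mem_ker] at hv ⊢
    rw [hfn, hv, map_zero]⟩
  let W' : Subrepresentation ρ := ⟨LinearMap.range (f ^ n), by
    rintro g _ ⟨m, rfl⟩
    exact ⟨ρ g m, hfn g m⟩⟩
  rcases hρ.2 W W' (isCompl_iff_toSubmodule.2 hn) with h | h
  · right
    have h1 : LinearMap.ker (f ^ n) = ⊥ := congrArg Subrepresentation.toSubmodule h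
    exact (isUnit_pow_iff hn0.ne').1 ((LinearMap.isUnit_iff_ker_eq_bot _).2 h1)
  · left
    have h1 : LinearMap.range (f ^ n) = ⊥ := congrArg Subrepresentation.toSubmodule h
    exact ⟨n, LinearMap.range_eq_bot.1 h1⟩

/-- The endomorphism ring of an indecomposable representation is local. -/
lemma IsIndecomposable.exists_isUnit (hρ : IsIndecomposable ρ) {ι : Type*} (s : Finset ι)
    (f : ι → Module.End k M) (hf : ∀ j g m, f j (ρ g m) = ρ g (f j m))
    (hs : IsUnit (∑ j ∈ s, f j)) : ∃ j ∈ s, IsUnit (f j) := by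
  classical
  induction s using Finset.induction_on with
  | empty =>
    have := hρ.1
    exact absurd hs (by simp)
  | insert a s ha ih =>
    rw [Finset.sum_insert ha] at hs
    set b := ∑ j ∈ s, f j with hb
    have hbG (g : G) (m : M) : b (ρ g m) = ρ g (b m) := by simp [hb, hf]
    obtain ⟨u, hu⟩ := hs
    have huG := units_inv_apply_comm (ρ := ρ) u fun g m => by simp [hu, hf, hbG]
    have h1 : (↑u⁻¹ : Module.End k M) * f a + ↑u⁻¹ * b = 1 := by
      rw [← mul_add, ← hu, Units.inv_mul]
    -- After normalising the sum to `1`, if one term is nilpotent then the other is `1` minus a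
    -- nilpotent, hence a unit.
    rcases hρ.isNilpotent_or_isUnit (↑u⁻¹ * f a) fun g m => by simp [hf, huG] with h | h
    · have : IsUnit (↑u⁻¹ * b) := by
        rw [eq_sub_of_add_eq' h1]
        exact h.isUnit_one_sub
      obtain ⟨j, hj, hju⟩ := ih ((Units.isUnit_units_mul _ _).1 this)
      exact ⟨j, Finset.mem_insert_of_mem hj, hju⟩
    · exact ⟨a, Finset.mem_insert_self _ _, (Units.isUnit_units_mul _ _).1 h⟩

end Fitting

/-! ### Sums over orbits modulo `p` -/

section Orbits

variable {Q β : Type*} [Group Q] [MulAction Q β]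

lemma sum_eq_sum_orbits {A : Type*} [AddCommMonoid A] [Fintype β]
    [Fintype (MulAction.orbitRel.Quotient Q β)]
    [∀ O : MulAction.orbitRel.Quotient Q β, Fintype (Q ⧸ MulAction.stabilizer Q O.out)]
    (F : β → A) :
    ∑ x, F x = ∑ O : MulAction.orbitRel.Quotient Q β,
      ∑ q : Q ⧸ MulAction.stabilizer Q O.out, F (q.out • O.out) := by
  rw [← Equiv.sum_comp (MulAction.selfEquivSigmaOrbitsQuotientStabilizer Q β).symm,
    Fintype.sum_sigma]
  refine Finset.sum_congr rfl fun O _ => Finset.sum_congr rfl fun q _ => congrArg F ?_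
  conv_lhs => rw [← QuotientGroup.out_eq' q]
  rfl

/-- An orbit contributes its length times a value of `F`, and the length of a nontrivial orbit is
divisible by `p`. -/
lemma sum_eq_zero_of_isPGroup {k : Type*} [Field k] (p : ℕ) [Fact p.Prime] [CharP k p]
    (hQ : IsPGroup p Q) [Finite Q] [Fintype β] (F : β → k) (hF : ∀ (g : Q) x, F (g • x) = F x)
    (hfix : ∀ x ∈ MulAction.fixedPoints Q β, F x = 0) : ∑ x, F x = 0 := by
  classical
  have := Fintype.ofFinite (MulAction.orbitRel.Quotient Q β)
  have := fun O : MulAction.orbitRel.Quotient Q β =>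
    Fintype.ofFinite (Q ⧸ MulAction.stabilizer Q O.out)
  rw [sum_eq_sum_orbits (Q := Q)]
  refine Finset.sum_eq_zero fun O _ => ?_
  simp only [hF, Finset.sum_const, nsmul_eq_mul, Finset.card_univ]
  obtain ⟨n, hn⟩ := hQ.index (MulAction.stabilizer Q O.out)
  rw [Subgroup.index, Nat.card_eq_fintype_card] at hn
  rcases Nat.eq_zero_or_pos n with rfl | h0
  · have h : MulAction.stabilizer Q O.out = ⊤ := by
      rw [← Subgroup.index_eq_one, Subgroup.index, Nat.card_eq_fintype_card, hn, pow_zero]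
    rw [hfix, mul_zero]
    intro g
    have : g ∈ MulAction.stabilizer Q O.out := h ▸ Subgroup.mem_top g
    exact this
  · rw [hn, Nat.cast_pow, CharP.cast_eq_zero, zero_pow h0.ne', zero_mul]

end Orbits

open Representation

/-! ### Matrices of endomorphisms of a summand of `kΩ` -/

section Matrix

variable {k G Ω M : Type*} [Field k] [Group G] [MulAction G Ω] [AddCommGroup M] [Module k M]
  (i : M →ₗ[k] MonoidAlgebra k Ω) (π : MonoidAlgebra k Ω →ₗ[k] M)

/-- The matrix of the endomorphism `i ∘ f ∘ π` of `kΩ`. -/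
noncomputable def matEntry (z : Ω × Ω) : Module.End k M →ₗ[k] k where
  toFun f := (i (f (π (.single z.2 1)))).coeff z.1
  map_add' f f' := by simp
  map_smul' c f := by simp

/-- The endomorphism of `M` obtained by sandwiching a matrix unit between `i` and `π`. -/
noncomputable def matUnit (z : Ω × Ω) : Module.End k M :=
  π ∘ₗ (MonoidAlgebra.lsingle z.1) ∘ₗ (Finsupp.lapply z.2) ∘ₗ
    (MonoidAlgebra.coeffLinearEquiv k).toLinearMap ∘ₗ i

lemma matUnit_apply (z : Ω × Ω) (m : M) :
    matUnit i π z m = π (.single z.1 ((i m).coeff z.2)) := rfl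

lemma single_eq_smul (x : Ω) (c : k) :
    (MonoidAlgebra.single x c : MonoidAlgebra k Ω) = c • .single x 1 := by
  simp

section Sum

variable {i π} [Fintype Ω]

lemma sum_single_coeff (v : MonoidAlgebra k Ω) :
    ∑ x, MonoidAlgebra.single x (v.coeff x) = v := by
  classical
  ext y
  simp

variable (hπi : ∀ m, π (i m) = m)
include hπi

/-- Insert `π ∘ i = 1` between the two factors and expand in the basis `Ω`. -/
lemma matEntry_mul (f f' : Module.End k M) (x y : Ω) :
    matEntry i π (x, y) (f * f') = ∑ ω, matEntry i π (x, ω) f * matEntry i π (ω, y) f' := by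
  simp only [matEntry, LinearMap.coe_mk, AddHom.coe_mk, Module.End.mul_apply]
  conv_lhs => rw [← hπi (f' (π (.single y 1))), ← sum_single_coeff (i (f' (π (.single y 1))))]
  simp only [single_eq_smul _ ((i (f' (π (.single y 1)))).coeff _), map_sum, map_smul]
  simp [mul_comm]

lemma sum_matEntry_smul_matUnit (f : Module.End k M) :
    ∑ z, matEntry i π z f • matUnit i π z = f := by
  ext m
  simp only [LinearMap.sum_apply, LinearMap.smul_apply, matUnit_apply]
  rw [Fintype.sum_prod_type_right]
  conv_rhs => rw [← hπi (f m), ← hπi m, ← sum_single_coeff (i m)]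
  simp only [map_sum]
  refine Finset.sum_congr rfl fun y _ => ?_
  conv_rhs => rw [← sum_single_coeff (i (f (π (.single y ((i m).coeff y)))))]
  simp only [map_sum]
  refine Finset.sum_congr rfl fun x _ => ?_
  rw [← map_smul]
  congr 1
  rw [single_eq_smul y ((i m).coeff y), map_smul, map_smul, map_smul]
  simp [matEntry, mul_comm]

end Sum

variable {i π} {ρ : Representation k G M} (hi : ∀ g m, i (ρ g m) = ofMulAction k G Ω g (i m))
  (hπ : ∀ g n, π (ofMulAction k G Ω g n) = ρ g (π n))
include hi hπ

lemma matEntry_linHom (f : Module.End k M) (g : G) (z : Ω × Ω) :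
    matEntry i π z (linHom ρ ρ g f) = matEntry i π (g⁻¹ • z) f := by
  simp only [matEntry, LinearMap.coe_mk, AddHom.coe_mk, linHom_apply, LinearMap.comp_apply, hi,
    coeff_ofMulAction, ← hπ, ofMulAction_single]
  rfl

lemma linHom_matUnit (g : G) (z : Ω × Ω) :
    linHom ρ ρ g (matUnit i π z) = matUnit i π (g • z) := by
  ext m
  simp only [linHom_apply, LinearMap.comp_apply, matUnit_apply, hi, coeff_ofMulAction, ← hπ,
    ofMulAction_single, inv_inv]
  rfl

end Matrix

/-! ### Vertices and fixed points -/

section Vertex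

variable {k : Type*} [Field k] (p : ℕ) [Fact p.Prime] [CharP k p] {G : Type*} [Group G] [Finite G]
  {M : Type*} [AddCommGroup M] [Module k M] {ρ : Representation k G M}

include p in
-- The index of a Sylow `p`-subgroup of `Q` is invertible in `k`, so dividing `θ` by it gives a
-- Higman witness for that subgroup; minimality forces equality with `Q`.
lemma IsVertex.isPGroup {Q : Subgroup G} (hQ : IsVertex ρ Q) : IsPGroup p Q := by
  let P : Sylow p Q := default
  let R : Subgroup G := (P : Subgroup Q).map Q.subtype
  have hRQ : R ≤ Q := Subgroup.map_subtype_le _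
  have hsub : R.subgroupOf Q = P := Subgroup.comap_map_eq_self_of_injective Q.subtype_injective _
  suffices h : IsRelativelyProjective ρ R by
    have hQR : Q ≤ R := hQ.2 h hRQ
    exact (P.2.map Q.subtype).to_le hQR
  obtain ⟨θ, hθ, hθ1⟩ := (isRelativelyProjective_iff ρ Q).1 hQ.1
  have hn : (((P : Subgroup Q).index : ℕ) : k) ≠ 0 := by
    rw [Ne, CharP.cast_eq_zero_iff k p]
    exact P.not_dvd_index
  rw [isRelativelyProjective_iff]
  have hfix : ∀ h ∈ R, linHom ρ ρ h ((((P : Subgroup Q).index : ℕ) : k)⁻¹ • θ) =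
      (((P : Subgroup Q).index : ℕ) : k)⁻¹ • θ := fun h hh => by rw [map_smul, hθ h (hRQ hh)]
  refine ⟨_, hfix, ?_⟩
  rw [← relTrace_trans _ hRQ hfix, relTrace_smul, hsub]
  have := Fintype.ofFinite (Q ⧸ (P : Subgroup Q))
  have : relTrace ((linHom ρ ρ).comp Q.subtype) P θ = (((P : Subgroup Q).index : ℕ) : k) • θ := by
    rw [relTrace_eq_sum, Finset.sum_congr rfl fun q _ => hθ q.out q.out.2]
    rw [Finset.sum_const, Finset.card_univ, Subgroup.index, Nat.card_eq_fintype_card,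
      Nat.cast_smul_eq_nsmul]
  rw [this, smul_smul, inv_mul_cancel₀ hn, one_smul, hθ1]

variable {Ω : Type*} [MulAction G Ω]
  {i : M →ₗ[k] MonoidAlgebra k Ω} {π : MonoidAlgebra k Ω →ₗ[k] M}
  (hi : ∀ g m, i (ρ g m) = ofMulAction k G Ω g (i m))
  (hπ : ∀ g n, π (ofMulAction k G Ω g n) = ρ g (π n)) (hπi : ∀ m, π (i m) = m)
include hi hπ

include p in
/-- A `p`-subgroup at which the Brauer construction of `M` does not vanish fixes a coset of every
subgroup relative to which `M` is projective. -/
lemma exists_mem_fixedPoints_quotient {P Q : Subgroup G} (hP : IsPGroup p P)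
    (hQ : IsRelativelyProjective ρ Q) {z : Ω × Ω} (hz : z ∈ MulAction.fixedPoints P (Ω × Ω))
    (h1 : matEntry i π z 1 ≠ 0) : (MulAction.fixedPoints P (G ⧸ Q)).Nonempty := by
  obtain ⟨θ, hθ, hθ1⟩ := (isRelativelyProjective_iff ρ Q).1 hQ
  have := Fintype.ofFinite (G ⧸ Q)
  by_contra! h
  refine h1 ?_
  rw [← hθ1, relTrace_eq_sum, map_sum]
  -- As `P` fixes `z`, the summand is constant on `P`-orbits of cosets.
  refine sum_eq_zero_of_isPGroup p hP _ (fun g q => ?_) fun q hq => by simp [h] at hq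
  rw [show g • q = (g : G) • q from rfl, apply_out_smul_of_fixed _ hθ, matEntry_linHom hi hπ]
  exact congrArg (fun w => matEntry i π w _) (hz g⁻¹)

include p hπi in
/-- The Brauer construction of `M` at a vertex does not vanish. -/
lemma IsVertex.exists_matEntry_ne_zero [Finite Ω] {Q : Subgroup G} (hQ : IsVertex ρ Q)
    (hρ : IsIndecomposable ρ) :
    ∃ z ∈ MulAction.fixedPoints Q (Ω × Ω), matEntry i π z 1 ≠ 0 := by
  classical
  by_contra! h0
  have hp := hQ.isPGroup p
  have := Fintype.ofFinite Ω
  have : FiniteDimensional k (MonoidAlgebra k Ω) :=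
    Module.Finite.equiv (MonoidAlgebra.coeffLinearEquiv (S := k) k).symm
  have : FiniteDimensional k M :=
    FiniteDimensional.of_injective i (Function.LeftInverse.injective hπi)
  obtain ⟨θ, hθ, hθ1⟩ := (isRelativelyProjective_iff ρ Q).1 hQ.1
  have hinv (f : Module.End k M) (hf : ∀ h ∈ Q, linHom ρ ρ h f = f) (g : Q) (z : Ω × Ω) :
      matEntry i π (g • z) f = matEntry i π z f := by
    have h := matEntry_linHom hi hπ f (g : G)⁻¹ z
    rw [hf _ (Q.inv_mem g.2), inv_inv] at h
    exact h.symm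
  have hone : ∀ h ∈ Q, linHom ρ ρ h 1 = 1 := fun h _ => by
    rw [linHom_eq_self_iff]
    exact fun _ => rfl
  have hθ0 : ∀ z ∈ MulAction.fixedPoints Q (Ω × Ω), matEntry i π z θ = 0 := by
    rintro ⟨x, y⟩ hz
    have hx (g : Q) : g • x = x := congrArg Prod.fst (hz g)
    have hy (g : Q) : g • y = y := congrArg Prod.snd (hz g)
    -- In the product `1 * θ` only `Q`-fixed `ω` survive modulo `p`, and there the entry of `1` is
    -- zero by `h0`.
    rw [← one_mul θ, matEntry_mul hπi]
    refine sum_eq_zero_of_isPGroup p hp _ (fun g ω => ?_) fun ω hω => ?_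
    · have h1 := hinv 1 hone g (x, ω)
      have h2 := hinv θ hθ g (ω, y)
      rw [Prod.smul_mk, hx] at h1
      rw [Prod.smul_mk, hy] at h2
      rw [h1, h2]
    · rw [h0 (x, ω) fun g => Prod.ext (hx g) (hω g), zero_mul]
  have := Fintype.ofFinite (MulAction.orbitRel.Quotient Q (Ω × Ω))
  have := fun O : MulAction.orbitRel.Quotient Q (Ω × Ω) =>
    Fintype.ofFinite (Q ⧸ MulAction.stabilizer Q O.out)
  let R (O : MulAction.orbitRel.Quotient Q (Ω × Ω)) : Subgroup G :=
    (MulAction.stabilizer Q O.out).map Q.subtype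
  have hRQ O : R O ≤ Q := Subgroup.map_subtype_le _
  have hsub O : (R O).subgroupOf Q = MulAction.stabilizer Q O.out :=
    Subgroup.comap_map_eq_self_of_injective Q.subtype_injective _
  have hfix O : ∀ h ∈ R O, linHom ρ ρ h (matUnit i π O.out) = matUnit i π O.out := by
    rintro _ ⟨h, hh, rfl⟩
    rw [linHom_matUnit hi hπ]
    congr 1
  -- The coefficients of `θ` are constant on `Q`-orbits of pairs, and each orbit of matrix units
  -- sums to a relative trace from a stabiliser.
  have hθsum : θ = ∑ O : MulAction.orbitRel.Quotient Q (Ω × Ω), matEntry i π O.out θ •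
      relTrace ((linHom ρ ρ).comp Q.subtype) ((R O).subgroupOf Q) (matUnit i π O.out) := by
    conv_lhs => rw [← sum_matEntry_smul_matUnit hπi θ, sum_eq_sum_orbits (Q := Q)]
    refine Finset.sum_congr rfl fun O _ => ?_
    rw [hsub, relTrace_eq_sum, Finset.smul_sum]
    refine Finset.sum_congr rfl fun q _ => ?_
    rw [hinv θ hθ]
    congr 1
    exact (linHom_matUnit hi hπ _ _).symm
  have hsum : ∑ O : MulAction.orbitRel.Quotient Q (Ω × Ω), matEntry i π O.out θ •
      relTrace (linHom ρ ρ) (R O) (matUnit i π O.out) = 1 := by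
    rw [← hθ1]
    conv_rhs => rw [hθsum]
    rw [relTrace_sum]
    refine Finset.sum_congr rfl fun O _ => ?_
    rw [relTrace_smul, relTrace_trans _ (hRQ O) (hfix O)]
  have hcomm O : ∀ g m, relTrace (linHom ρ ρ) (R O) (matUnit i π O.out) (ρ g m) =
      ρ g (relTrace (linHom ρ ρ) (R O) (matUnit i π O.out) m) := fun g =>
    (linHom_eq_self_iff ρ ρ _ g).1 (apply_relTrace _ (hfix O) g)
  obtain ⟨O, -, hO⟩ := hρ.exists_isUnit _ _ (fun O g m => by simp [hcomm O])
    (hsum ▸ isUnit_one)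
  have hne : matEntry i π O.out θ ≠ 0 := by
    rintro h
    have := hρ.1
    rw [h, zero_smul] at hO
    exact not_isUnit_zero hO
  have hrel : IsRelativelyProjective ρ (R O) := by
    rw [isRelativelyProjective_iff]
    obtain ⟨u, hu⟩ := hO
    have huG := units_inv_apply_comm (ρ := ρ) u fun g m => by simp [hu, hcomm]
    let T : Module.End k M →ₗ[k] Module.End k M := LinearMap.mulLeft k (↑u⁻¹ : Module.End k M)
    have hT (g : G) (f : Module.End k M) : T (linHom ρ ρ g f) = linHom ρ ρ g (T f) := by
      ext m
      exact huG g _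
    -- Multiplying by the equivariant inverse `u⁻¹` turns the unit trace into `1`.
    refine ⟨T (matEntry i π O.out θ • matUnit i π O.out), fun h hh => ?_, ?_⟩
    · rw [← hT, map_smul, hfix O h hh]
    · rw [← map_relTrace T hT, relTrace_smul, ← hu]
      exact Units.inv_mul u
  -- Minimality gives `Q ≤ R O`, so `Q` fixes the pair `O.out`, where `θ` has entry zero.
  refine hne (hθ0 _ fun g => ?_)
  obtain ⟨g', hg', hgg'⟩ := hQ.2 hrel (hRQ O) g.2
  rwa [Subtype.ext hgg'] at hg'

end Vertex

end ModRep

theorem theorem2p3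
    {k : Type*} [Field k] (p : ℕ) [Fact p.Prime] [CharP k p]
    {G : Type*} [Group G] [Finite G]
    {Ω : Type*} [Finite Ω] [MulAction G Ω]
    {M : Type*} [AddCommGroup M] [Module k M] (ρ : Representation k G M)
    (hsummand : ModRep.IsSummand ρ (Representation.ofMulAction k G Ω))
    (hindec : ModRep.IsIndecomposable ρ)
    (Q : Subgroup G) (hQ : ModRep.IsVertex ρ Q) :
    ∃ P : Sylow p (fixingSubgroup G (MulAction.fixedPoints Q Ω)),
      (P : Subgroup (fixingSubgroup G (MulAction.fixedPoints Q Ω))).map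
        (fixingSubgroup G (MulAction.fixedPoints Q Ω)).subtype = Q := by
  obtain ⟨i, π, hi, hπ, hπi⟩ := ModRep.isSummand_iff.1 hsummand
  set S := fixingSubgroup G (MulAction.fixedPoints Q Ω) with hS
  have hQS : Q ≤ S := fun g hg => (mem_fixingSubgroup_iff G).2 fun x hx => hx ⟨g, hg⟩
  obtain ⟨P, hP⟩ := ((hQ.isPGroup p).comap_subtype (K := S)).exists_le_sylow
  refine ⟨P, ?_⟩
  have hQP : Q ≤ (P : Subgroup S).map S.subtype := fun g hg => ⟨⟨g, hQS hg⟩, hP hg, rfl⟩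
  obtain ⟨z, hz, hz1⟩ := hQ.exists_matEntry_ne_zero p hi hπ hπi hindec
  have hzP : z ∈ MulAction.fixedPoints ((P : Subgroup S).map S.subtype) (Ω × Ω) := by
    rintro ⟨_, g, -, rfl⟩
    have hg := (mem_fixingSubgroup_iff G).1 g.2
    exact Prod.ext (hg z.1 fun h => congrArg Prod.fst (hz h))
      (hg z.2 fun h => congrArg Prod.snd (hz h))
  obtain ⟨q, hq⟩ := ModRep.exists_mem_fixedPoints_quotient p hi hπ (P.2.map S.subtype) hQ.1 hzP hz1
  -- Conjugation by a representative of the fixed coset `q` embeds `P` in `Q`.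
  refine (Subgroup.eq_of_le_of_card_ge hQP ?_).symm
  refine Nat.card_le_card_of_injective
    (fun u : (P : Subgroup S).map S.subtype => (⟨q.out⁻¹ * u * q.out, ?_⟩ : Q)) fun u v huv => ?_
  · have h := hq u
    rw [← QuotientGroup.out_eq' q] at h
    have h' : ((q.out : G) : G ⧸ Q) = ((u * q.out : G) : G ⧸ Q) := h.symm
    rw [QuotientGroup.eq, ← mul_assoc] at h'
    exact h'
  · simpa using huv
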